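/- Let $q\ge 1$, $\sigma>0$, and let $X_1,\dots,X_n$ be independent random vectors with $X_i\sim\mathcal N(\mu_i,\sigma^2 I_q)$, $\mu_i\in\mathbb R^q$; let $X\in\mathbb R^{n\times q}$ be the matrix with rows $X_1,\dots,X_n$. For $A\in\mathbb R^{n\times q}$ let $\mathcal C(A)$ be the outcome of $J\ge 0$ iterations of $K$-means clustering (Lloyd's algorithm) of the rows of $A$, that is, the cluster assignments of all rows at all steps $0,1,\dots,J$: at step $0$ each row is assigned to the nearest of $K$ initial centers, given by a (measurable) function $m^{(0)}$ of $A$; at each later step each row is assigned to the nearest of the $K$ averages of the clusters formed at the previous step. (Ties go to the smallest index; an empty cluster keeps its previous center.) Let $\mathcal C_1,\dots,\mathcal C_K$ be the clusters given by the last step of $\mathcal C(X)$. Let $\mathcal V$ be a fixed nonempty set of pairs $(k,k')$ with $1\le k<k'\le K$. For $(k,k')\in\mathcal V$ put $v_{k,k'}=\mathbf 1_{\mathcal C_k}/|\mathcal C_k|-\mathbf 1_{\mathcal C_{k'}}/|\mathcal C_{k'}|\in\mathbb R^n$, let $\mathcal E=\operatorname{span}\{v_{k,k'}:(k,k')\in\mathcal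 V\}$, let $P_{\mathcal E}$ be the matrix of the orthogonal projection onto $\mathcal E$, $P_{\mathcal E}^\perp=I_n-P_{\mathcal E}$, $d=q\cdot\dim\mathcal E$, and $$T_\sigma=\frac{\|P_{\mathcal E}X\|_F}{\sigma},\qquad Z=\Big(\frac{P_{\mathcal E}X}{\|P_{\mathcal E}X\|_F},\,P_{\mathcal E}^\perp X\Big),\qquad x_\sigma(\psi)=\psi\,\frac{\sigma P_{\mathcal E}X}{\|P_{\mathcal E}X\|_F}+P_{\mathcal E}^\perp X\quad(\psi\ge 0).$$ Let $Q_\sigma$ be the conditional CDF of $T_\sigma$ given $\mathcal C(X)$ and $Z$, and $p_\sigma=1-Q_\sigma(T_\sigma)$. The null hypothesis $H_{0,\mathcal V}$, which depends on $\mathcal C(X)$, states that $\frac1{|\mathcal C_k|}\sum_{i\in\mathcal C_k}\mu_i=\frac1{|\mathcal C_{k'}|}\sum_{i\in\mathcal C_{k'}}\mu_i$ for all $(k,k')\in\mathcal V$. Then: (i) Almost surely, whenever the outcome $\mathcal C(X)$ is such that the clusters occurring in $\mathcal V$ are nonempty and $H_{0,\mathcal V}$ holds, $Q_\sigma$ is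 the CDF of the $\chi_d$ distribution truncated to $\mathcal S_\sigma=\{\psi\ge 0:\mathcal C(X)=\mathcal C(x_\sigma(\psi))\}$. (ii) For every outcome $c$ with $\mathbb P(\mathcal C(X)=c)>0$ for which the clusters occurring in $\mathcal V$ are nonempty and $H_{0,\mathcal V}$ holds, and every $\alpha\in[0,1]$, $\mathbb P(p_\sigma\le\alpha\mid\mathcal C(X)=c)=\alpha$. -/

import Mathlib

open MeasureTheory ProbabilityTheory
open scoped Matrix

noncomputable section

namespace ClusterInference

/-- Matrices carry the product (Borel) σ-algebra of their entries. -/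
instance instMeasurableSpaceMatrix (n q : ℕ) : MeasurableSpace (Matrix (Fin n) (Fin q) ℝ) :=
  (inferInstance : MeasurableSpace (Fin n → Fin q → ℝ))

/-- The `i`-th row of a matrix, as a vector of Euclidean space. -/
def row {n q : ℕ} (A : Matrix (Fin n) (Fin q) ℝ) (i : Fin n) : EuclideanSpace ℝ (Fin q) :=
  WithLp.toLp 2 (A i)

/-- The Frobenius norm. -/
def frob {n q : ℕ} (A : Matrix (Fin n) (Fin q) ℝ) : ℝ :=
  Real.sqrt (∑ i, ∑ j, A i j ^ 2)

/-! ### K-means clustering (Lloyd's algorithm) -/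

open Classical in
/-- The indices of the centers that are closest to `x`. -/
def closest {K q : ℕ} (m : Fin K → EuclideanSpace ℝ (Fin q)) (x : EuclideanSpace ℝ (Fin q)) :
    Finset (Fin K) :=
  Finset.univ.filter fun l => ∀ l', ‖x - m l‖ ≤ ‖x - m l'‖

theorem closest_nonempty {K q : ℕ} [NeZero K] (m : Fin K → EuclideanSpace ℝ (Fin q))
    (x : EuclideanSpace ℝ (Fin q)) : (closest m x).Nonempty := by
  obtain ⟨l, hl⟩ := Finite.exists_min fun l => ‖x - m l‖
  exact ⟨l, by simpa [closest] using hl⟩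

/-- The index of the closest center; ties are broken in favour of the smallest index. -/
def nearest {K q : ℕ} [NeZero K] (m : Fin K → EuclideanSpace ℝ (Fin q))
    (x : EuclideanSpace ℝ (Fin q)) : Fin K :=
  (closest m x).min' (closest_nonempty m x)

/-- The members of the `k`-th cluster of a cluster assignment. -/
def members {n K : ℕ} (a : Fin n → Fin K) (k : Fin K) : Finset (Fin n) :=
  Finset.univ.filter fun i => a i = k

/-- The average `∑ i ∈ s, x i / |s|`. -/
def average {n q : ℕ} (x : Fin n → EuclideanSpace ℝ (Fin q)) (s : Finset (Fin n)) :
    EuclideanSpace ℝ (Fin q) :=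
  (s.card : ℝ)⁻¹ • ∑ i ∈ s, x i

/-- The cluster centers used at step `j` of the algorithm: at step `0` the initial centers, at step
`j + 1` the averages over the clusters formed at step `j` (an empty cluster keeps its center). -/
def centers {n K q : ℕ} [NeZero K]
    (m₀ : Matrix (Fin n) (Fin q) ℝ → Fin K → EuclideanSpace ℝ (Fin q))
    (A : Matrix (Fin n) (Fin q) ℝ) : ℕ → Fin K → EuclideanSpace ℝ (Fin q)
  | 0 => m₀ A
  | j + 1 => fun l =>
      let a : Fin n → Fin K := fun i => nearest (centers m₀ A j) (row A i)
      if (members a l).card = 0 then centers m₀ A j l else average (row A) (members a l)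

/-- The outcome of `K`-means clustering of the rows of a matrix: the assignments of all rows at
steps `0, …, J`. -/
abbrev Outcome (n K J : ℕ) : Type := Fin (J + 1) → Fin n → Fin K

/-- The outcome `𝒞(A)` of `J` iterations of `K`-means clustering with initialization `m₀`. -/
def kmeans {n K q : ℕ} [NeZero K] (J : ℕ)
    (m₀ : Matrix (Fin n) (Fin q) ℝ → Fin K → EuclideanSpace ℝ (Fin q))
    (A : Matrix (Fin n) (Fin q) ℝ) : Outcome n K J :=
  fun j i => nearest (centers m₀ A j) (row A i)

/-- The `k`-th estimated cluster `𝒞_k`: the one produced by the last iteration. -/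
def cluster {n K J : ℕ} (c : Outcome n K J) (k : Fin K) : Finset (Fin n) :=
  members (c (Fin.last J)) k

/-! ### The null hypothesis, the test statistic and the truncation set -/

/-- The clusters that are tested are not empty, so that their averages are meaningful. -/
def TestedNonempty {n K J : ℕ} (V : Finset (Fin K × Fin K)) (c : Outcome n K J) : Prop :=
  ∀ p ∈ V, (cluster c p.1).Nonempty ∧ (cluster c p.2).Nonempty

/-- The null hypothesis `H_{0,𝒱}` for the clusters of the outcome `c`. -/
def NullHypothesis {n K q J : ℕ} (μ : Fin n → EuclideanSpace ℝ (Fin q))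
    (V : Finset (Fin K × Fin K)) (c : Outcome n K J) : Prop :=
  ∀ p ∈ V, average μ (cluster c p.1) = average μ (cluster c p.2)

/-- The vector `1_s / |s|`. -/
def normIndicator {n : ℕ} (s : Finset (Fin n)) : EuclideanSpace ℝ (Fin n) :=
  WithLp.toLp 2 fun i => if i ∈ s then (s.card : ℝ)⁻¹ else 0

/-- The contrast vector `v_{k,k'}`. -/
def contrast {n K J : ℕ} (c : Outcome n K J) (k k' : Fin K) : EuclideanSpace ℝ (Fin n) :=
  normIndicator (cluster c k) - normIndicator (cluster c k')

/-- The space `𝓔` spanned by the contrast vectors of the tested pairs. -/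
def contrastSpace {n K J : ℕ} (V : Finset (Fin K × Fin K)) (c : Outcome n K J) :
    Submodule ℝ (EuclideanSpace ℝ (Fin n)) :=
  Submodule.span ℝ {v | ∃ p ∈ V, v = contrast c p.1 p.2}

/-- The matrix `P_𝓔` of the orthogonal projection onto `𝓔`. -/
def projMatrix {n K J : ℕ} (V : Finset (Fin K × Fin K)) (c : Outcome n K J) :
    Matrix (Fin n) (Fin n) ℝ :=
  (Matrix.toEuclideanCLM (n := Fin n) (𝕜 := ℝ)).symm (contrastSpace V c).starProjection

/-- The test statistic `‖P_𝓔 A‖_F / σ`, where `𝓔` is the space of the outcome `c`. -/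
def testStat {n K q J : ℕ} (σ : ℝ) (V : Finset (Fin K × Fin K)) (c : Outcome n K J)
    (A : Matrix (Fin n) (Fin q) ℝ) : ℝ :=
  frob (projMatrix V c * A) / σ

/-- The pair `(P_𝓔 A / ‖P_𝓔 A‖_F, P_𝓔^⊥ A)`, where `𝓔` is the space of the outcome `c`. -/
def nuisance {n K q J : ℕ} (V : Finset (Fin K × Fin K)) (c : Outcome n K J)
    (A : Matrix (Fin n) (Fin q) ℝ) : Matrix (Fin n) (Fin q) ℝ × Matrix (Fin n) (Fin q) ℝ :=
  ((frob (projMatrix V c * A))⁻¹ • (projMatrix V c * A), (1 - projMatrix V c) * A)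

/-- The perturbed data `x_σ(ψ)` for the data matrix `A` and the space `𝓔` of the outcome `c`. -/
def perturb {n K q J : ℕ} (σ : ℝ) (V : Finset (Fin K × Fin K)) (c : Outcome n K J)
    (A : Matrix (Fin n) (Fin q) ℝ) (ψ : ℝ) : Matrix (Fin n) (Fin q) ℝ :=
  ψ • ((σ / frob (projMatrix V c * A)) • (projMatrix V c * A)) + (1 - projMatrix V c) * A

/-- The truncation set `S_σ = {ψ ≥ 0 : 𝒞(A) = 𝒞(x_σ(ψ))}` for the data matrix `A`. -/
def truncSet {n K q : ℕ} [NeZero K] (J : ℕ)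
    (m₀ : Matrix (Fin n) (Fin q) ℝ → Fin K → EuclideanSpace ℝ (Fin q))
    (σ : ℝ) (V : Finset (Fin K × Fin K)) (A : Matrix (Fin n) (Fin q) ℝ) : Set ℝ :=
  {ψ | 0 ≤ ψ ∧ kmeans J m₀ A = kmeans J m₀ (perturb σ V (kmeans J m₀ A) A ψ)}

/-! ### Distributions -/

/-- The `χ²_d` distribution: the law of the sum of the squares of `d` independent standard normal
variables. -/
def chiSquaredMeasure (d : ℕ) : Measure ℝ :=
  (Measure.pi fun _ : Fin d => gaussianReal 0 1).map fun z => ∑ i, z i ^ 2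

/-- The `χ_d` distribution: the law of the square root of a `χ²_d` variable. -/
def chiMeasure (d : ℕ) : Measure ℝ :=
  (chiSquaredMeasure d).map Real.sqrt

/-- The CDF at `t` of the distribution `ν` truncated to `S`, that is, of `ν` conditioned on `S`. -/
def truncCDF (ν : Measure ℝ) (S : Set ℝ) (t : ℝ) : ℝ :=
  (ν[|S]).real (Set.Iic t)

/-! ### The random objects -/

/-- The random data matrix whose rows are the observations. -/
def dataMatrix {Ω : Type*} {n q : ℕ} (X : Fin n → Ω → EuclideanSpace ℝ (Fin q)) (ω : Ω) :
    Matrix (Fin n) (Fin q) ℝ :=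
  Matrix.of fun i j => X i ω j

/-- `𝒞(X)`. -/
def outcome {Ω : Type*} {n K q : ℕ} [NeZero K] (J : ℕ)
    (m₀ : Matrix (Fin n) (Fin q) ℝ → Fin K → EuclideanSpace ℝ (Fin q))
    (X : Fin n → Ω → EuclideanSpace ℝ (Fin q)) (ω : Ω) : Outcome n K J :=
  kmeans J m₀ (dataMatrix X ω)

/-- `T_σ`. -/
def Tσ {Ω : Type*} {n K q : ℕ} [NeZero K] (J : ℕ)
    (m₀ : Matrix (Fin n) (Fin q) ℝ → Fin K → EuclideanSpace ℝ (Fin q))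
    (σ : ℝ) (V : Finset (Fin K × Fin K)) (X : Fin n → Ω → EuclideanSpace ℝ (Fin q)) (ω : Ω) : ℝ :=
  testStat σ V (outcome J m₀ X ω) (dataMatrix X ω)

/-- `(𝒞(X), Z)`. -/
def conditioning {Ω : Type*} {n K q : ℕ} [NeZero K] (J : ℕ)
    (m₀ : Matrix (Fin n) (Fin q) ℝ → Fin K → EuclideanSpace ℝ (Fin q))
    (V : Finset (Fin K × Fin K)) (X : Fin n → Ω → EuclideanSpace ℝ (Fin q)) (ω : Ω) :
    Outcome n K J × (Matrix (Fin n) (Fin q) ℝ × Matrix (Fin n) (Fin q) ℝ) :=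
  (outcome J m₀ X ω, nuisance V (outcome J m₀ X ω) (dataMatrix X ω))

/-- `Q_σ`: the conditional CDF of `T_σ` given `𝒞(X)` and `Z`, a random function. -/
def Qσ {Ω : Type*} [MeasurableSpace Ω] (P : Measure Ω) [IsProbabilityMeasure P]
    {n K q : ℕ} [NeZero K] (J : ℕ)
    (m₀ : Matrix (Fin n) (Fin q) ℝ → Fin K → EuclideanSpace ℝ (Fin q))
    (σ : ℝ) (V : Finset (Fin K × Fin K)) (X : Fin n → Ω → EuclideanSpace ℝ (Fin q)) (ω : Ω)
    (t : ℝ) : ℝ :=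
  cdf (condDistrib (Tσ J m₀ σ V X) (conditioning J m₀ V X) P (conditioning J m₀ V X ω)) t

/-- The selective p-value `p_σ = 1 - Q_σ(T_σ)`. -/
def pσ {Ω : Type*} [MeasurableSpace Ω] (P : Measure Ω) [IsProbabilityMeasure P]
    {n K q : ℕ} [NeZero K] (J : ℕ)
    (m₀ : Matrix (Fin n) (Fin q) ℝ → Fin K → EuclideanSpace ℝ (Fin q))
    (σ : ℝ) (V : Finset (Fin K × Fin K)) (X : Fin n → Ω → EuclideanSpace ℝ (Fin q)) (ω : Ω) : ℝ :=
  1 - Qσ P J m₀ σ V X ω (Tσ J m₀ σ V X ω)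

end ClusterInference

end

/-! Fix an outcome `c`, so that `𝓔` becomes a deterministic space. The null hypothesis for `c` says
that every column of the mean matrix is orthogonal to `𝓔`, so the data projected to `𝓔` are centred
isotropic Gaussian. Orthogonal components of an isotropic Gaussian vector are independent, and so
are the norm and direction of a centred one. Hence the versions `T_c`, `Z_c` of the statistics built
from this fixed `𝓔` are independent, with `T_c` following `χ_d` (`exists_map_polar_starProjection`,
transported to the data in `exists_map_nuisance_testStat`).

The data can be rebuilt from `(Z_c, T_c)`, so the event `𝒞(X) = c` says exactly that this pair lies
in a fixed measurable set (`kmeans_eq_iff_mem_selectionSet`). On that event `T = T_c` and `Z = Z_c`.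
Conditioning a product law on a measurable set truncates the second factor to the section at the
first coordinate (`condDistrib_eq_cond`), and the section at `Z` is `S_σ`. There are finitely many
outcomes, so the exceptional null sets can be united, which gives (i).

For (ii), each truncated law with nonzero normaliser has no atoms. The probability integral
transform applies on each section, and integrating over `z` gives `cond_one_sub_cdf_condDistrib_le`.
The clustering algorithm enters only through its measurability. -/

namespace ClusterInference

/-! ### Polar coordinates of a standard Gaussian vector. -/

section Gaussian

variable {E : Type*} [NormedAddCommGroup E] [InnerProductSpace ℝ E] [FiniteDimensional ℝ E]
  [MeasurableSpace E] [BorelSpace E]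

/-- The standard Gaussian measure has a density that depends on the norm only. -/
theorem stdGaussian_eq_withDensity :
    stdGaussian E = (volume : Measure E).withDensity fun x =>
      ENNReal.ofReal (((2 * Real.pi) ^ (Module.finrank ℝ E / 2 : ℝ))⁻¹ *
        Real.exp (-(1 / 2) * ‖x‖ ^ 2)) := by
  set a : ℝ := (2 * Real.pi) ^ (Module.finrank ℝ E / 2 : ℝ) with ha
  have ha0 : 0 < a := by positivity
  -- The density is the norm of the complex Gaussian integrand at frequency zero.
  have hint : Integrable (fun x : E => a⁻¹ * Real.exp (-(1 / 2) * ‖x‖ ^ 2)) := by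
    have h := (GaussianFourier.integrable_cexp_neg_mul_sq_norm_add (V := E) (b := (1 / 2 : ℂ))
      (by norm_num) 0 0).norm
    refine (h.const_mul a⁻¹).congr (Filter.Eventually.of_forall fun x => ?_)
    simp [Complex.norm_exp, ← Complex.ofReal_pow]
  have hfin : IsFiniteMeasure ((volume : Measure E).withDensity fun x =>
      ENNReal.ofReal (a⁻¹ * Real.exp (-(1 / 2) * ‖x‖ ^ 2))) :=
    isFiniteMeasure_withDensity_ofReal hint.2
  refine Measure.ext_of_charFun (funext fun t => ?_)
  rw [charFun_stdGaussian, charFun_apply, integral_withDensity_eq_integral_toReal_smul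
    (by fun_prop) (by simp)]
  have h := GaussianFourier.integral_cexp_neg_mul_sq_norm_add (V := E) (b := (1 / 2 : ℂ))
    (by norm_num) Complex.I t
  have h2 : ∀ x : E, (ENNReal.ofReal (a⁻¹ * Real.exp (-(1 / 2) * ‖x‖ ^ 2))).toReal •
      Complex.exp ((inner ℝ x t : ℝ) * Complex.I) =
      (a⁻¹ : ℂ) * Complex.exp (-(1 / 2) * ‖x‖ ^ 2 + Complex.I * (inner ℝ t x : ℝ)) := by
    intro x
    rw [ENNReal.toReal_ofReal (by positivity), Complex.real_smul, Complex.exp_add,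
      real_inner_comm x t]
    push_cast
    ring_nf
  simp_rw [h2]
  rw [integral_const_mul, h, ← mul_assoc]
  have h3 : ((Real.pi : ℂ) / (1 / 2)) ^ (Module.finrank ℝ E / 2 : ℂ) = (a : ℂ) := by
    rw [ha, Complex.ofReal_cpow (by positivity)]
    push_cast
    ring_nf
  rw [h3, inv_mul_cancel₀ (by exact_mod_cast ha0.ne'), one_mul]
  congr 1
  simp
  ring

/-- Integration in polar coordinates of a product of a radial and an angular function. -/
theorem lintegral_norm_mul_direction [Nontrivial E] (f : ℝ → ENNReal) (hf : Measurable f)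
    (g : E → ENNReal) (hg : Measurable g) :
    ∫⁻ x : E, f ‖x‖ * g (‖x‖⁻¹ • x) =
      (∫⁻ r, f r.1 ∂Measure.volumeIoiPow (Module.finrank ℝ E - 1)) *
        ∫⁻ u, g u.1 ∂(volume : Measure E).toSphere := by
  -- The origin is a null set because `E` is nontrivial; off it, the polar homeomorphism carries the
  -- volume to a product measure.
  calc ∫⁻ x : E, f ‖x‖ * g (‖x‖⁻¹ • x)
      = ∫⁻ x : ({0}ᶜ : Set E), f ‖x.1‖ * g (‖x.1‖⁻¹ • x.1) ∂(volume : Measure E).comap (↑) := by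
        rw [lintegral_subtype_comap (measurableSet_singleton _).compl
          (fun x : E => f ‖x‖ * g (‖x‖⁻¹ • x)), restrict_compl_singleton]
    _ = ∫⁻ p, f p.2.1 * g p.1.1 ∂(volume : Measure E).toSphere.prod
          (Measure.volumeIoiPow (Module.finrank ℝ E - 1)) := by
        rw [← ((volume : Measure E).measurePreserving_homeomorphUnitSphereProd).lintegral_comp_emb
          (Homeomorph.measurableEmbedding _)]
        simp
    _ = _ := by
        rw [lintegral_prod _ (by fun_prop)]
        have : ∀ u : Metric.sphere (0 : E) 1,
            ∫⁻ r, f r.1 * g u.1 ∂Measure.volumeIoiPow (Module.finrank ℝ E - 1) =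
            (∫⁻ r, f r.1 ∂Measure.volumeIoiPow (Module.finrank ℝ E - 1)) * g u.1 :=
          fun u => lintegral_mul_const _ (by fun_prop)
        simp_rw [this]
        rw [lintegral_const_mul _ (by fun_prop)]

/-- The norm and the direction of a standard Gaussian vector are independent. -/
theorem indepFun_norm_direction_stdGaussian [Nontrivial E] :
    IndepFun (fun x : E => ‖x‖) (fun x : E => ‖x‖⁻¹ • x) (stdGaussian E) := by
  obtain ⟨φ, hφ, hφE⟩ : ∃ φ : ℝ → ENNReal, Measurable φ ∧
      stdGaussian E = (volume : Measure E).withDensity fun x => φ ‖x‖ :=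
    ⟨fun r => ENNReal.ofReal (((2 * Real.pi) ^ (Module.finrank ℝ E / 2 : ℝ))⁻¹ *
        Real.exp (-(1 / 2) * r ^ 2)), by fun_prop, stdGaussian_eq_withDensity⟩
  set R : Set ℝ → ENNReal := fun s =>
    ∫⁻ r, s.indicator φ r.1 ∂Measure.volumeIoiPow (Module.finrank ℝ E - 1)
  set S : Set E → ENNReal := fun s =>
    ∫⁻ u, s.indicator 1 u.1 ∂(volume : Measure E).toSphere
  have key : ∀ s : Set ℝ, ∀ t : Set E, MeasurableSet s → MeasurableSet t →
      stdGaussian E ((fun x : E => ‖x‖) ⁻¹' s ∩ (fun x : E => ‖x‖⁻¹ • x) ⁻¹' t) = R s * S t := by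
    intro s t hs ht
    have hm : MeasurableSet ((fun x : E => ‖x‖) ⁻¹' s ∩ (fun x : E => ‖x‖⁻¹ • x) ⁻¹' t) :=
      (measurable_norm hs).inter ((by fun_prop : Measurable fun x : E => ‖x‖⁻¹ • x) ht)
    rw [← lintegral_norm_mul_direction _ (hφ.indicator hs) _ (measurable_one.indicator ht), hφE,
      withDensity_apply _ hm, ← lintegral_indicator hm]
    congr 1 with x
    by_cases h1 : ‖x‖ ∈ s <;> by_cases h2 : ‖x‖⁻¹ • x ∈ t <;> simp [h1, h2]
  -- `R` and `S` need not be probability measures separately; only the product of their total masses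
  -- has to be one.
  have hone : R Set.univ * S Set.univ = 1 := by
    rw [← key _ _ .univ .univ]; simp
  refine indepFun_iff_measure_inter_preimage_eq_mul.2 fun s t hs ht => ?_
  have h1 := key s Set.univ hs .univ
  have h2 := key Set.univ t .univ ht
  simp only [Set.preimage_univ, Set.inter_univ, Set.univ_inter] at h1 h2
  rw [key s t hs ht, h1, h2]
  calc R s * S t = R s * S t * (R Set.univ * S Set.univ) := by rw [hone, mul_one]
    _ = _ := by ring

/-- The norm of a standard Gaussian vector has the `χ` distribution. -/
theorem map_norm_stdGaussian : (stdGaussian E).map norm = chiMeasure (Module.finrank ℝ E) := by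
  rw [stdGaussian, chiMeasure, chiSquaredMeasure, Measure.map_map (by fun_prop) (by fun_prop),
    Measure.map_map (by fun_prop) (by fun_prop)]
  congr 1 with x
  simp only [Function.comp_apply]
  rw [eq_comm, Real.sqrt_eq_iff_mul_self_eq (by positivity) (norm_nonneg _), ← pow_two,
    ← real_inner_self_eq_norm_sq, (stdOrthonormalBasis ℝ E).orthonormal.inner_sum]
  simp [pow_two]

/-- A standard Gaussian vector has polar coordinates that follow a product measure. -/
theorem map_norm_direction_stdGaussian [Nontrivial E] :
    (stdGaussian E).map (fun x : E => (‖x‖, ‖x‖⁻¹ • x)) =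
      (chiMeasure (Module.finrank ℝ E)).prod ((stdGaussian E).map fun x : E => ‖x‖⁻¹ • x) := by
  rw [(indepFun_iff_map_prod_eq_prod_map_map (by fun_prop) (by fun_prop)).1
    indepFun_norm_direction_stdGaussian, ← map_norm_stdGaussian]

instance (d : ℕ) : IsProbabilityMeasure (chiMeasure d) := by
  have h : IsProbabilityMeasure (chiSquaredMeasure d) :=
    Measure.isProbabilityMeasure_map (Measurable.aemeasurable (by fun_prop))
  exact Measure.isProbabilityMeasure_map (by fun_prop)

/-- Spheres are Lebesgue null, and the standard Gaussian is absolutely continuous. Dimension zero is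
excluded: there the law is a point mass at `0`. -/
theorem nullSingletonClass_chiMeasure {d : ℕ} (hd : 0 < d) : NullSingletonClass (chiMeasure d) := by
  have : Nontrivial (EuclideanSpace ℝ (Fin d)) :=
    Module.finrank_pos_iff (R := ℝ).1 (by simpa using hd)
  refine ⟨fun r => ?_⟩
  have h := map_norm_stdGaussian (E := EuclideanSpace ℝ (Fin d))
  rw [finrank_euclideanSpace_fin] at h
  rw [← h, Measure.map_apply measurable_norm (measurableSet_singleton r),
    stdGaussian_eq_withDensity]
  refine withDensity_absolutelyContinuous _ _ ?_
  have h2 : (norm ⁻¹' {r} : Set (EuclideanSpace ℝ (Fin d))) = Metric.sphere 0 r := by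
    ext x; simp
  rw [h2]
  exact Measure.addHaar_sphere _ _ _

end Gaussian

/-! ### The probability integral transform for atomless laws. -/

section ProbabilityIntegralTransform

variable (ν : Measure ℝ) [IsProbabilityMeasure ν] [NullSingletonClass ν]

/-- The jump of the CDF at a point is the mass of that point. -/
theorem continuous_cdf : Continuous (cdf ν) := by
  refine continuous_iff_continuousAt.2 fun x => ?_
  rw [(monotone_cdf ν).continuousAt_iff_leftLim_eq_rightLim, StieltjesFunction.rightLim_eq]
  refine le_antisymm ((monotone_cdf ν).leftLim_le le_rfl) ?_
  have h := StieltjesFunction.measure_singleton (cdf ν) x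
  rw [measure_cdf, measure_singleton, eq_comm, ENNReal.ofReal_eq_zero] at h
  linarith

/-- For a law without atoms, `F(T)` is uniformly distributed. -/
theorem measure_cdf_lt {β : ℝ} (h0 : 0 ≤ β) (h1 : β ≤ 1) :
    ν {t | cdf ν t < β} = ENNReal.ofReal β := by
  have attained : ∀ b : ℝ, 0 < b → b < 1 → ∃ s, cdf ν s = b := fun b hb0 hb1 =>
    mem_range_of_exists_le_of_exists_ge (continuous_cdf ν)
      (((tendsto_cdf_atBot ν).eventually_lt_const hb0).exists.imp fun _ h => h.le)
      (((tendsto_cdf_atTop ν).eventually_const_lt hb1).exists.imp fun _ h => h.le)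
  refine le_antisymm ?_ ?_
  · rcases h1.eq_or_lt with rfl | h1
    · simpa using prob_le_one
    rcases h0.eq_or_lt with rfl | h0
    · have : {t | cdf ν t < 0} = ∅ := by
        ext t; simpa using cdf_nonneg ν t
      simp [this]
    obtain ⟨s, hs⟩ := attained β h0 h1
    rw [← hs, ofReal_cdf]
    exact measure_mono fun t ht => ((monotone_cdf ν).reflect_lt ht).le
  -- Approximation from below: if the CDF takes a value `b < β` at `s`, then by monotonicity the
  -- half-line up to `s` lies in the set, and it has mass `b`.
  · refine le_of_forall_lt fun a ha => ?_
    obtain ⟨b, hab, hb⟩ := exists_between ha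
    have hbt : b ≠ ⊤ := hb.ne_top
    have hb0 : 0 < b.toReal := ENNReal.toReal_pos (pos_of_gt hab).ne' hbt
    have hbβ : b.toReal < β := by
      rwa [ENNReal.lt_ofReal_iff_toReal_lt hbt] at hb
    obtain ⟨s, hs⟩ := attained b.toReal hb0 (hbβ.trans_le h1)
    calc a < b := hab
      _ = ν (Set.Iic s) := by rw [← ofReal_cdf, hs, ENNReal.ofReal_toReal hbt]
      _ ≤ _ := measure_mono fun t ht => ((monotone_cdf ν ht).trans hs.le).trans_lt hbβ

theorem measure_one_sub_cdf_le {α : ℝ} (h0 : 0 ≤ α) (h1 : α ≤ 1) :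
    ν {t | 1 - cdf ν t ≤ α} = ENNReal.ofReal α := by
  have hm : MeasurableSet {t | cdf ν t < 1 - α} :=
    measurableSet_lt (monotone_cdf ν).measurable measurable_const
  have h : {t | 1 - cdf ν t ≤ α} = {t | cdf ν t < 1 - α}ᶜ := by
    ext t
    simp only [Set.mem_ofPred_eq, Set.mem_compl_iff, not_lt]
    constructor <;> intro h <;> linarith
  rw [h, prob_compl_eq_one_sub hm, measure_cdf_lt ν (by linarith) (by linarith),
    ← ENNReal.ofReal_one, ← ENNReal.ofReal_sub _ (by linarith)]
  congr 1
  ring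

end ProbabilityIntegralTransform

/-! ### Truncation of a law to the sections of a measurable set. -/

section Truncation

variable {ζ : Type*} [MeasurableSpace ζ] (χ : Measure ℝ) [IsProbabilityMeasure χ]

/-- The kernel that sends `z` to the measure `χ` truncated to the section of `S` at `z`. -/
noncomputable def truncKernel (S : Set (ζ × ℝ)) (hS : MeasurableSet S) : Kernel ζ ℝ where
  toFun z := χ[|Prod.mk z ⁻¹' S]
  measurable' := by
    refine Measure.measurable_of_measurable_coe _ fun B hB => ?_
    have h : ∀ z, χ[|Prod.mk z ⁻¹' S] B =
        (χ (Prod.mk z ⁻¹' S))⁻¹ * χ (Prod.mk z ⁻¹' (S ∩ Set.univ ×ˢ B)) := by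
      intro z
      rw [cond_apply (measurable_prodMk_left hS)]
      congr 2
      ext t
      simp
    simp_rw [h]
    exact (measurable_measure_prodMk_left hS).inv.mul
      (measurable_measure_prodMk_left (hS.inter (MeasurableSet.univ.prod hB)))

variable {S : Set (ζ × ℝ)} (hS : MeasurableSet S)

theorem truncKernel_apply (z : ζ) : truncKernel χ S hS z = χ[|Prod.mk z ⁻¹' S] := rfl

/-- The kernel need not be Markov: at a section of `χ`-mass zero, conditioning returns the zero
measure. -/
instance : IsFiniteKernel (truncKernel χ S hS) := by
  refine ⟨1, ENNReal.one_lt_top, fun z => ?_⟩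
  rw [truncKernel_apply, cond_apply (measurable_prodMk_left hS), Set.inter_univ]
  exact ENNReal.inv_mul_le_one _

/-- The section and the threshold vary together, so the value is read as the mass that a kernel
gives to a section of the closed set `{p.2 ≤ p.1.2}`. -/
theorem measurable_truncCDF {S : Set (ζ × ℝ)} (hS : MeasurableSet S) :
    Measurable fun p : ζ × ℝ => truncCDF χ (Prod.mk p.1 ⁻¹' S) p.2 := by
  have h : MeasurableSet {p : (ζ × ℝ) × ℝ | p.2 ≤ p.1.2} :=
    measurableSet_le measurable_snd measurable_fst.snd
  exact (Kernel.measurable_kernel_prodMk_left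
    (κ := (truncKernel χ S hS).comap Prod.fst measurable_fst) h).ennreal_toReal

/-- Uniformity of the p-value on one section, in unnormalised form so that it survives null sections
and can be integrated over `z`. -/
theorem measure_truncCDF_inter [NullSingletonClass χ] {s : Set ℝ} (hs : MeasurableSet s) {α : ℝ}
    (h0 : 0 ≤ α) (h1 : α ≤ 1) :
    χ (s ∩ {t | 1 - truncCDF χ s t ≤ α}) = ENNReal.ofReal α * χ s := by
  by_cases h : χ s = 0
  · rw [h, mul_zero]
    exact measure_mono_null Set.inter_subset_left h
  have : IsProbabilityMeasure χ[|s] := cond_isProbabilityMeasure h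
  have : NullSingletonClass χ[|s] := ⟨fun x => cond_absolutelyContinuous (measure_singleton x)⟩
  have h2 := measure_one_sub_cdf_le χ[|s] h0 h1
  simp_rw [cdf_eq_real] at h2
  rw [← cond_mul_eq_inter hs]
  exact congrArg (· * χ s) h2

end Truncation

/-! ### Conditioning a product law on a selection event. -/

section Conditioning

variable {Ω ι ζ : Type*} [MeasurableSpace Ω] [MeasurableSpace ι] [MeasurableSingletonClass ι]
  [MeasurableSpace ζ] {P : Measure Ω} [IsProbabilityMeasure P]
  {χ : Measure ℝ} [IsProbabilityMeasure χ] {ν : Measure ζ}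
  {C : Ω → ι} {Z Zc : Ω → ζ} {T Tc : Ω → ℝ} {c : ι} {S : Set (ζ × ℝ)}

/-- If `(Z, T)` agrees, on the event `C = c`, with a pair that follows a product measure `ν ⊗ χ`, and
`C = c` means that this pair lies in `S`, then given `C = c` and `Z` the conditional distribution of
`T` is `χ` truncated to the section of `S` at `Z`. -/
theorem condDistrib_eq_cond (hC : Measurable C) (hZ : Measurable Z) (hT : Measurable T)
    (hZc : Measurable Zc) (hTc : Measurable Tc) (hS : MeasurableSet S)
    (hZeq : ∀ ω, C ω = c → Z ω = Zc ω) (hTeq : ∀ ω, C ω = c → T ω = Tc ω)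
    (hlaw : P.map (fun ω => (Zc ω, Tc ω)) = ν.prod χ)
    (hCS : ∀ ω, C ω = c ↔ (Zc ω, Tc ω) ∈ S) :
    ∀ᵐ ω ∂P, C ω = c →
      condDistrib T (fun ω => (C ω, Z ω)) P (C ω, Z ω) = χ[|Prod.mk (Z ω) ⁻¹' S] := by
  set Y : Ω → ι × ζ := fun ω => (C ω, Z ω) with hYdef
  have hY : Measurable Y := hC.prodMk hZ
  set D : Set (ι × ζ) := {c} ×ˢ Set.univ with hDdef
  have hD : MeasurableSet D := (measurableSet_singleton c).prod .univ
  set κ : Kernel (ι × ζ) ℝ := (truncKernel χ S hS).comap Prod.snd measurable_snd with hκ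
  -- A kernel is determined almost everywhere by its composition product, so both candidates are
  -- compared on rectangles, with the law of `(C, Z)` restricted to `C = c`.
  have key : ((P.map Y).restrict D) ⊗ₘ condDistrib T Y P = ((P.map Y).restrict D) ⊗ₘ κ := by
    refine Measure.ext_prod fun {A B} hA hB => ?_
    have hA' : MeasurableSet {z | (c, z) ∈ A} := measurable_prodMk_left hA
    have hE : MeasurableSet (S ∩ {z | (c, z) ∈ A} ×ˢ Set.univ) := hS.inter (hA'.prod .univ)
    have hE2 : MeasurableSet (S ∩ {z | (c, z) ∈ A} ×ˢ B) := hS.inter (hA'.prod hB)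
    have hpre : Y ⁻¹' (A ∩ D) = (fun ω => (Zc ω, Tc ω)) ⁻¹' (S ∩ {z | (c, z) ∈ A} ×ˢ Set.univ) := by
      ext ω
      simp only [hYdef, hDdef, Set.mem_preimage, Set.mem_inter_iff, Set.mem_prod,
        Set.mem_singleton_iff, Set.mem_univ, and_true, Set.mem_ofPred_eq, ← hCS]
      constructor
      · rintro ⟨h1, h2⟩
        exact ⟨h2, by rwa [← h2, ← hZeq ω h2]⟩
      · rintro ⟨h1, h2⟩
        exact ⟨by rwa [h1, hZeq ω h1], h1⟩
    have hpre2 : (fun ω => (Y ω, T ω)) ⁻¹' ((A ∩ D) ×ˢ B) =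
        (fun ω => (Zc ω, Tc ω)) ⁻¹' (S ∩ {z | (c, z) ∈ A} ×ˢ B) := by
      ext ω
      simp only [hYdef, hDdef, Set.mem_preimage, Set.mem_inter_iff, Set.mem_prod,
        Set.mem_singleton_iff, Set.mem_univ, and_true, Set.mem_ofPred_eq, ← hCS]
      constructor
      · rintro ⟨⟨h1, h2⟩, h3⟩
        exact ⟨h2, by rwa [← h2, ← hZeq ω h2], by rwa [← hTeq ω h2]⟩
      · rintro ⟨h1, h2, h3⟩
        exact ⟨⟨by rwa [h1, hZeq ω h1], h1⟩, by rwa [hTeq ω h1]⟩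
    have hmeas : Measurable fun p : ζ × ℝ => truncKernel χ S hS p.1 B :=
      (Kernel.measurable_coe _ hB).comp measurable_fst
    rw [Measure.compProd_apply_prod hA hB, Measure.compProd_apply_prod hA hB,
      Measure.restrict_restrict hA, ← Measure.compProd_apply_prod (hA.inter hD) hB,
      compProd_map_condDistrib hT.aemeasurable,
      Measure.map_apply (hY.prodMk hT) ((hA.inter hD).prod hB), hpre2,
      ← Measure.map_apply (hZc.prodMk hTc) hE2, hlaw,
      setLIntegral_map (hA.inter hD) (Kernel.measurable_coe _ hB) hY, hpre]
    have hcongr : ∫⁻ ω in (fun ω => (Zc ω, Tc ω)) ⁻¹' (S ∩ {z | (c, z) ∈ A} ×ˢ Set.univ),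
          κ (Y ω) B ∂P =
        ∫⁻ ω in (fun ω => (Zc ω, Tc ω)) ⁻¹' (S ∩ {z | (c, z) ∈ A} ×ˢ Set.univ),
          truncKernel χ S hS (Zc ω, Tc ω).1 B ∂P := by
      refine setLIntegral_congr_fun ((hZc.prodMk hTc) hE) fun ω hω => ?_
      have h1 : C ω = c := (hCS ω).2 hω.1
      simp [hκ, hYdef, hZeq ω h1]
    -- By Fubini the claim reduces to one `z`: the mass of a section times the truncated mass of `B`
    -- is the mass of their intersection, also for null sections.
    rw [hcongr, ← setLIntegral_map hE hmeas (hZc.prodMk hTc), hlaw,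
      ← lintegral_indicator hE, Measure.prod_apply hE2,
      lintegral_prod _ (hmeas.indicator hE).aemeasurable]
    refine lintegral_congr fun z => ?_
    by_cases hz : (c, z) ∈ A
    · have h1 : Prod.mk z ⁻¹' (S ∩ {z | (c, z) ∈ A} ×ˢ B) = Prod.mk z ⁻¹' S ∩ B := by
        ext t; simp [hz]
      have h2 : ∀ t, (S ∩ {z | (c, z) ∈ A} ×ˢ Set.univ).indicator
          (fun p : ζ × ℝ => truncKernel χ S hS p.1 B) (z, t) =
          (Prod.mk z ⁻¹' S).indicator (fun _ => truncKernel χ S hS z B) t := by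
        intro t
        by_cases ht : (z, t) ∈ S <;> simp [ht, hz]
      simp_rw [h2]
      rw [h1, lintegral_indicator (measurable_prodMk_left hS), setLIntegral_const,
        truncKernel_apply, cond_mul_eq_inter (measurable_prodMk_left hS)]
    · have h1 : Prod.mk z ⁻¹' (S ∩ {z | (c, z) ∈ A} ×ˢ B) = ∅ := by
        ext t; simp [hz]
      simp [h1, hz]
  have hae := Kernel.ae_eq_of_compProd_eq key
  rw [Filter.EventuallyEq, ae_restrict_iff' hD] at hae
  filter_upwards [ae_of_ae_map hY.aemeasurable hae] with ω hω h
  exact hω ⟨h, Set.mem_univ _⟩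

theorem cdf_condDistrib_eq_truncCDF (hC : Measurable C) (hZ : Measurable Z) (hT : Measurable T)
    (hZc : Measurable Zc) (hTc : Measurable Tc) (hS : MeasurableSet S)
    (hZeq : ∀ ω, C ω = c → Z ω = Zc ω) (hTeq : ∀ ω, C ω = c → T ω = Tc ω)
    (hlaw : P.map (fun ω => (Zc ω, Tc ω)) = ν.prod χ)
    (hCS : ∀ ω, C ω = c ↔ (Zc ω, Tc ω) ∈ S) :
    ∀ᵐ ω ∂P, C ω = c → ∀ t,
      cdf (condDistrib T (fun ω => (C ω, Z ω)) P (C ω, Z ω)) t =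
        truncCDF χ (Prod.mk (Z ω) ⁻¹' S) t := by
  filter_upwards [condDistrib_eq_cond hC hZ hT hZc hTc hS hZeq hTeq hlaw hCS] with ω hω h t
  rw [cdf_eq_real, hω h, truncCDF]

/-- Under the assumptions of `condDistrib_eq_cond`, one minus the conditional CDF at `T` is uniformly
distributed given `C = c`. -/
theorem cond_one_sub_cdf_condDistrib_le [NullSingletonClass χ]
    (hC : Measurable C) (hZ : Measurable Z) (hT : Measurable T)
    (hZc : Measurable Zc) (hTc : Measurable Tc) (hS : MeasurableSet S)
    (hZeq : ∀ ω, C ω = c → Z ω = Zc ω) (hTeq : ∀ ω, C ω = c → T ω = Tc ω)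
    (hlaw : P.map (fun ω => (Zc ω, Tc ω)) = ν.prod χ)
    (hCS : ∀ ω, C ω = c ↔ (Zc ω, Tc ω) ∈ S) (hc : P {ω | C ω = c} ≠ 0)
    {α : ℝ} (h0 : 0 ≤ α) (h1 : α ≤ 1) :
    P[{ω | 1 - cdf (condDistrib T (fun ω => (C ω, Z ω)) P (C ω, Z ω)) (T ω) ≤ α} |
      {ω | C ω = c}] = ENNReal.ofReal α := by
  have hCm : MeasurableSet {ω | C ω = c} := hC (measurableSet_singleton c)
  have hEm : MeasurableSet (S ∩ {p | 1 - truncCDF χ (Prod.mk p.1 ⁻¹' S) p.2 ≤ α}) :=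
    hS.inter (measurableSet_le (measurable_const.sub (measurable_truncCDF χ hS)) measurable_const)
  have hP : P {ω | C ω = c} = ∫⁻ z, χ (Prod.mk z ⁻¹' S) ∂ν := by
    have : {ω | C ω = c} = (fun ω => (Zc ω, Tc ω)) ⁻¹' S := by ext ω; simp [hCS]
    rw [this, ← Measure.map_apply (hZc.prodMk hTc) hS, hlaw, Measure.prod_apply hS]
  have hE : P ({ω | C ω = c} ∩
      {ω | 1 - cdf (condDistrib T (fun ω => (C ω, Z ω)) P (C ω, Z ω)) (T ω) ≤ α}) =
      ENNReal.ofReal α * P {ω | C ω = c} := by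
    calc _ = P ((fun ω => (Zc ω, Tc ω)) ⁻¹'
          (S ∩ {p | 1 - truncCDF χ (Prod.mk p.1 ⁻¹' S) p.2 ≤ α})) := by
          refine measure_congr ?_
          filter_upwards [cdf_condDistrib_eq_truncCDF hC hZ hT hZc hTc hS hZeq hTeq hlaw hCS]
            with ω hω
          refine propext ?_
          change (C ω = c ∧ _ ≤ α) ↔ ((Zc ω, Tc ω) ∈ S ∧ _ ≤ α)
          rw [← hCS]
          refine and_congr_right fun h => ?_
          rw [hω h, hZeq ω h, hTeq ω h]
      _ = ENNReal.ofReal α * P {ω | C ω = c} := by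
          rw [← Measure.map_apply (hZc.prodMk hTc) hEm, hlaw, Measure.prod_apply hEm, hP,
            ← lintegral_const_mul _ (measurable_measure_prodMk_left hS)]
          exact lintegral_congr fun z =>
            measure_truncCDF_inter χ (measurable_prodMk_left hS) h0 h1
  rw [cond_apply hCm, hE, mul_comm, mul_assoc, ENNReal.mul_inv_cancel hc (measure_ne_top _ _),
    mul_one]

end Conditioning

/-! ### Orthogonal decomposition of Gaussian vectors. -/

section Decomposition

variable {H : Type*} [NormedAddCommGroup H] [InnerProductSpace ℝ H] [FiniteDimensional ℝ H]
  [MeasurableSpace H] [BorelSpace H] (F : Submodule ℝ H)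

/-- The components of a standard Gaussian vector in orthogonal subspaces are independent standard
Gaussian vectors. -/
theorem map_orthogonalProjectionOnto_stdGaussian :
    (stdGaussian H).map (fun g => (F.orthogonalProjectionOnto g, Fᗮ.orthogonalProjectionOnto g)) =
      (stdGaussian F).prod (stdGaussian Fᗮ) := by
  have : IsProbabilityMeasure ((stdGaussian H).map
      (fun g => (F.orthogonalProjectionOnto g, Fᗮ.orthogonalProjectionOnto g))) :=
    Measure.isProbabilityMeasure_map (by fun_prop)
  refine charFun_eq_prod_iff.1 fun t => ?_
  rw [Measure.map_map (by fun_prop) (by fun_prop), charFun_apply,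
    integral_map (by fun_prop) (by fun_prop)]
  -- Pairing the two components with `t` is pairing `g` with the sum of the parts of `t`; Pythagoras
  -- then factors the characteristic function.
  have h : ∀ g : H, inner ℝ ((WithLp.toLp 2 ∘ fun g : H =>
      (F.orthogonalProjectionOnto g, Fᗮ.orthogonalProjectionOnto g)) g) t =
      inner ℝ g ((t.ofLp.1 : H) + (t.ofLp.2 : H)) := by
    intro g
    rw [Function.comp_apply, WithLp.prod_inner_apply, inner_add_right]
    congr 1 <;> simp
  simp_rw [h]
  rw [← charFun_apply, charFun_stdGaussian, charFun_stdGaussian, charFun_stdGaussian,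
    ← Complex.exp_add]
  have h2 := norm_add_sq_eq_norm_sq_add_norm_sq_real (x := (t.ofLp.1 : H)) (y := (t.ofLp.2 : H))
    (Submodule.inner_right_of_mem_orthogonal t.ofLp.1.2 t.ofLp.2.2)
  congr 1
  norm_cast
  rw [pow_two, h2]
  simp only [Submodule.coe_norm]
  ring

/-- For a Gaussian vector `x` with covariance `σ² I` whose mean is orthogonal to `F`, the scaled norm
of the projection `p` of `x` to `F` has the `χ` distribution, and is independent of the direction of
`p` and of `x - p`. -/
theorem exists_map_polar_starProjection [Nontrivial F] {σ : ℝ} (hσ : 0 < σ) {M : H} (hM : M ∈ Fᗮ) :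
    ∃ ν : Measure (H × H), IsProbabilityMeasure ν ∧
      ((stdGaussian H).map fun g => M + σ • g).map (fun x =>
        ((‖F.starProjection x‖⁻¹ • F.starProjection x, x - F.starProjection x),
          ‖F.starProjection x‖ / σ)) = ν.prod (chiMeasure (Module.finrank ℝ F)) := by
  set D : Measure F := (stdGaussian F).map fun a => ‖a‖⁻¹ • a
  have hD : IsProbabilityMeasure D := Measure.isProbabilityMeasure_map (by fun_prop)
  set A : Fᗮ → H := fun b => M + σ • (b : H)
  have hA : Measurable A := by fun_prop
  have hco : Measurable (Subtype.val : F → H) := measurable_subtype_coe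
  have hD' : IsProbabilityMeasure (D.map Subtype.val) :=
    Measure.isProbabilityMeasure_map hco.aemeasurable
  have hA' : IsProbabilityMeasure ((stdGaussian Fᗮ).map A) :=
    Measure.isProbabilityMeasure_map hA.aemeasurable
  -- The direction in `F` and the component in `Fᗮ` are themselves independent; the mean shifts only
  -- the latter.
  refine ⟨(D.map Subtype.val).prod ((stdGaussian Fᗮ).map A), inferInstance, ?_⟩
  have hP : F.starProjection M = 0 :=
    (Submodule.starProjection_apply_eq_zero_iff F).2 hM
  have hfun : (fun x => ((‖F.starProjection x‖⁻¹ • F.starProjection x, x - F.starProjection x),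
        ‖F.starProjection x‖ / σ)) ∘ (fun g => M + σ • g) =
      (Prod.map (Prod.map Subtype.val A) id ∘ Prod.swap ∘ MeasurableEquiv.prodAssoc ∘
        Prod.map (fun a : F => (‖a‖, ‖a‖⁻¹ • a)) id) ∘
        (fun g => (F.orthogonalProjectionOnto g, Fᗮ.orthogonalProjectionOnto g)) := by
    funext g
    have h1 : F.starProjection (M + σ • g) = σ • (F.orthogonalProjectionOnto g : H) := by
      rw [map_add, hP, zero_add, map_smul, Submodule.starProjection_apply]
    have h2 : M + σ • g - σ • (F.orthogonalProjectionOnto g : H) =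
        M + σ • (Fᗮ.orthogonalProjectionOnto g : H) := by
      have h : (Fᗮ.orthogonalProjectionOnto g : H) = g - F.orthogonalProjectionOnto g :=
        Submodule.starProjection_orthogonal_val g
      rw [h, smul_sub]
      abel
    simp only [Function.comp_apply, h1, h2, norm_smul, Real.norm_of_nonneg hσ.le]
    refine Prod.ext (Prod.ext ?_ rfl) ?_
    · change (σ * ‖(F.orthogonalProjectionOnto g : H)‖)⁻¹ • σ • (F.orthogonalProjectionOnto g : H) =
        ‖(F.orthogonalProjectionOnto g : H)‖⁻¹ • (F.orthogonalProjectionOnto g : H)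
      rw [smul_smul, mul_inv, mul_right_comm, inv_mul_cancel₀ hσ.ne', one_mul]
    · change σ * ‖(F.orthogonalProjectionOnto g : H)‖ / σ = ‖(F.orthogonalProjectionOnto g : H)‖
      rw [mul_div_cancel_left₀ _ hσ.ne']
  have hmap : Measurable (Prod.map (Prod.map (Subtype.val : F → H) A) (id : ℝ → ℝ)) :=
    (hco.prodMap hA).prodMap measurable_id
  have hpol : Measurable fun a : F => (‖a‖, ‖a‖⁻¹ • a) := by fun_prop
  rw [Measure.map_map (by fun_prop) (by fun_prop), hfun,
    ← Measure.map_map (by fun_prop) (by fun_prop), map_orthogonalProjectionOnto_stdGaussian,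
    ← Measure.map_map hmap (by fun_prop), ← Measure.map_map measurable_swap (by fun_prop),
    ← Measure.map_map (by fun_prop) (by fun_prop), ← Measure.map_prod_map _ _ hpol measurable_id,
    Measure.map_id, map_norm_direction_stdGaussian, Measure.prodAssoc_prod, Measure.prod_swap,
    ← Measure.map_prod_map _ _ (hco.prodMap hA) measurable_id, Measure.map_id,
    ← Measure.map_prod_map _ _ hco hA]

end Decomposition

/-! ### The joint law of the observations. -/

section DataSpace

variable {n q : ℕ}

/-- The space of data matrices, with the Frobenius norm. -/
abbrev DataSpace (n q : ℕ) : Type := PiLp 2 fun _ : Fin n => EuclideanSpace ℝ (Fin q)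

/-- Independent isotropic Gaussian observations form an isotropic Gaussian vector. -/
theorem map_data_eq_map_stdGaussian {Ω : Type*} [MeasurableSpace Ω] {P : Measure Ω}
    [IsProbabilityMeasure P] {σ : ℝ} {μ : Fin n → EuclideanSpace ℝ (Fin q)}
    {X : Fin n → Ω → EuclideanSpace ℝ (Fin q)} (hX : ∀ i, Measurable (X i))
    (hindep : iIndepFun X P)
    (hlaw : ∀ i, P.map (X i) =
      multivariateGaussian (μ i) (σ ^ 2 • (1 : Matrix (Fin q) (Fin q) ℝ))) :
    P.map (fun ω => (WithLp.toLp 2 fun i => X i ω : DataSpace n q)) =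
      (stdGaussian (DataSpace n q)).map fun g => WithLp.toLp 2 μ + σ • g := by
  have hS : (σ ^ 2 • (1 : Matrix (Fin q) (Fin q) ℝ)).PosSemidef :=
    Matrix.PosSemidef.one.smul (sq_nonneg σ)
  have hXm : Measurable fun ω => (fun i => X i ω) := measurable_pi_lambda _ hX
  have h1 : P.map (fun ω => (WithLp.toLp 2 fun i => X i ω : DataSpace n q)) =
      (Measure.pi fun i => P.map (X i)).map (WithLp.toLp 2) := by
    rw [← (iIndepFun_iff_map_fun_eq_pi_map fun i => (hX i).aemeasurable).1 hindep,
      Measure.map_map (by fun_prop) hXm]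
    rfl
  have hpr : ∀ i, IsProbabilityMeasure (P.map (X i)) := fun i =>
    Measure.isProbabilityMeasure_map (hX i).aemeasurable
  have hp1 : IsProbabilityMeasure
      (P.map (fun ω => (WithLp.toLp 2 fun i => X i ω : DataSpace n q))) :=
    Measure.isProbabilityMeasure_map (Measurable.aemeasurable (by fun_prop))
  have hp2 : IsProbabilityMeasure
      ((stdGaussian (DataSpace n q)).map fun g => (WithLp.toLp 2 μ : DataSpace n q) + σ • g) :=
    Measure.isProbabilityMeasure_map (by fun_prop)
  refine Measure.ext_of_charFun (funext fun t => ?_)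
  rw [h1, charFun_pi]
  have h2 : charFun ((stdGaussian (DataSpace n q)).map
      fun g => (WithLp.toLp 2 μ : DataSpace n q) + σ • g) t =
      Complex.exp ((inner ℝ (WithLp.toLp 2 μ : DataSpace n q) t : ℝ) * Complex.I) *
        charFun (stdGaussian (DataSpace n q)) (σ • t) := by
    rw [charFun_apply, charFun_apply, integral_map (by fun_prop) (by fun_prop),
      ← integral_const_mul]
    refine integral_congr_ae (Filter.Eventually.of_forall fun g => ?_)
    simp only [inner_add_left, real_inner_smul_left, real_inner_smul_right]
    rw [← Complex.exp_add]
    push_cast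
    ring_nf
  rw [h2, charFun_stdGaussian, norm_smul, Complex.ofReal_mul, mul_pow,
    ← Complex.ofReal_pow ‖σ‖, Real.norm_eq_abs, sq_abs, ← Complex.exp_add]
  have h3 : ∀ i, charFun (P.map (X i)) (t i) =
      Complex.exp ((inner ℝ (μ i) (t i) : ℝ) * Complex.I -
        ((σ ^ 2 * ‖t i‖ ^ 2 / 2 : ℝ) : ℂ)) := by
    intro i
    rw [hlaw, charFun_multivariateGaussian hS, real_inner_comm, Matrix.smul_mulVec,
      Matrix.one_mulVec, dotProduct_smul, EuclideanSpace.real_norm_sq_eq]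
    congr 1
    simp only [dotProduct, smul_eq_mul, ← pow_two]
    push_cast
    ring
  simp_rw [h3]
  rw [← Complex.exp_sum, PiLp.inner_apply, ← Complex.ofReal_pow ‖t‖,
    PiLp.norm_sq_eq_of_L2]
  congr 1
  rw [Finset.sum_sub_distrib, ← Finset.sum_mul]
  push_cast
  rw [← Finset.sum_div, ← Finset.mul_sum]
  ring

end DataSpace

/-! ### Columnwise projection and the contrast space. -/

section Columns

variable {n q : ℕ}

/-- The matrix of an element of the data space. -/
def toMatrix (x : DataSpace n q) : Matrix (Fin n) (Fin q) ℝ :=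
  Matrix.of fun i j => x i j

theorem toMatrix_apply (x : DataSpace n q) (i : Fin n) (j : Fin q) : toMatrix x i j = x i j := rfl

/-- The `j`-th column. -/
def column (j : Fin q) : DataSpace n q →ₗ[ℝ] EuclideanSpace ℝ (Fin n) where
  toFun x := WithLp.toLp 2 fun i => x i j
  map_add' _ _ := rfl
  map_smul' _ _ := rfl

theorem column_apply (j : Fin q) (x : DataSpace n q) (i : Fin n) : column j x i = x i j := rfl

theorem inner_eq_sum_column (x y : DataSpace n q) :
    inner ℝ x y = ∑ j, inner ℝ (column j x) (column j y) := by
  simp only [PiLp.inner_apply, column_apply]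
  exact Finset.sum_comm

/-- The data whose columns lie in `E`. -/
def columnSpace (q : ℕ) (E : Submodule ℝ (EuclideanSpace ℝ (Fin n))) :
    Submodule ℝ (DataSpace n q) :=
  ⨅ j, E.comap (column j)

variable {E : Submodule ℝ (EuclideanSpace ℝ (Fin n))}

theorem mem_columnSpace {x : DataSpace n q} : x ∈ columnSpace q E ↔ ∀ j, column j x ∈ E := by
  simp [columnSpace]

theorem mem_columnSpace_orthogonal {x : DataSpace n q} (hx : ∀ j, column j x ∈ Eᗮ) :
    x ∈ (columnSpace q E)ᗮ := by
  refine (Submodule.mem_orthogonal _ _).2 fun y hy => ?_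
  rw [inner_eq_sum_column]
  exact Finset.sum_eq_zero fun j _ =>
    Submodule.inner_right_of_mem_orthogonal (mem_columnSpace.1 hy j) (hx j)

/-- Inner products of data are sums over columns, so the columnwise projection has the two
properties that characterise the orthogonal projection. -/
theorem column_starProjection (x : DataSpace n q) (j : Fin q) :
    column j ((columnSpace q E).starProjection x) = E.starProjection (column j x) := by
  set u : DataSpace n q :=
    WithLp.toLp 2 fun i => WithLp.toLp 2 fun j => E.starProjection (column j x) i
  have hu : ∀ j, column j u = E.starProjection (column j x) := fun j => rfl
  rw [Submodule.eq_starProjection_of_mem_orthogonal (u := x) (v := u) (K := columnSpace q E), hu]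
  · refine mem_columnSpace.2 fun j => ?_
    rw [hu]
    exact Submodule.starProjection_apply_mem _ _
  · refine mem_columnSpace_orthogonal fun j => ?_
    rw [map_sub, hu]
    exact Submodule.sub_starProjection_mem_orthogonal _

/-- Data with columns in `E` are families of elements of `E`. -/
def columnSpaceEquiv : columnSpace q E ≃ₗ[ℝ] (Fin q → E) where
  toFun x j := ⟨column j x.1, mem_columnSpace.1 x.2 j⟩
  map_add' _ _ := rfl
  map_smul' _ _ := rfl
  invFun y := ⟨WithLp.toLp 2 fun i => WithLp.toLp 2 fun j => (y j : EuclideanSpace ℝ (Fin n)) i,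
    mem_columnSpace.2 fun j => (y j).2⟩
  left_inv _ := rfl
  right_inv _ := rfl

theorem finrank_columnSpace :
    Module.finrank ℝ (columnSpace q E) = q * Module.finrank ℝ E := by
  rw [columnSpaceEquiv.finrank_eq, Module.finrank_pi_fintype]
  simp

theorem frob_toMatrix (x : DataSpace n q) : frob (toMatrix x) = ‖x‖ := by
  rw [frob, eq_comm, ← Real.sqrt_sq (norm_nonneg x), PiLp.norm_sq_eq_of_L2]
  simp [EuclideanSpace.real_norm_sq_eq, toMatrix_apply]

theorem frob_eq_zero {A : Matrix (Fin n) (Fin q) ℝ} (h : frob A = 0) : A = 0 := by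
  have h2 : A = toMatrix (WithLp.toLp 2 fun i => WithLp.toLp 2 (A i)) := rfl
  rw [h2, frob_toMatrix, norm_eq_zero] at h
  rw [h2, h]
  rfl

variable {K J : ℕ} (V : Finset (Fin K × Fin K)) (c : Outcome n K J)

theorem toMatrix_starProjection (x : DataSpace n q) :
    toMatrix ((columnSpace q (contrastSpace V c)).starProjection x) =
      projMatrix V c * toMatrix x := by
  ext i j
  have h : (contrastSpace V c).starProjection =
      Matrix.toEuclideanCLM (n := Fin n) (𝕜 := ℝ) (projMatrix V c) := by
    simp [projMatrix]
  rw [toMatrix_apply, ← column_apply, column_starProjection, h]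
  rfl

theorem testStat_toMatrix (σ : ℝ) (x : DataSpace n q) :
    testStat σ V c (toMatrix x) =
      ‖(columnSpace q (contrastSpace V c)).starProjection x‖ / σ := by
  rw [testStat, ← toMatrix_starProjection, frob_toMatrix]

theorem nuisance_toMatrix (x : DataSpace n q) :
    nuisance V c (toMatrix x) = Prod.map toMatrix toMatrix
      (‖(columnSpace q (contrastSpace V c)).starProjection x‖⁻¹ •
        (columnSpace q (contrastSpace V c)).starProjection x,
        x - (columnSpace q (contrastSpace V c)).starProjection x) := by
  rw [nuisance, Matrix.sub_mul, Matrix.one_mul, ← toMatrix_starProjection, frob_toMatrix]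
  rfl

variable {V c}

theorem inner_normIndicator (s : Finset (Fin n)) (v : EuclideanSpace ℝ (Fin n)) :
    inner ℝ (normIndicator s) v = (s.card : ℝ)⁻¹ * ∑ i ∈ s, v i := by
  rw [Finset.mul_sum]
  simp [normIndicator, PiLp.inner_apply, mul_comm]

/-- Under the null hypothesis the mean is orthogonal to the contrasts. -/
theorem toLp_mem_columnSpace_orthogonal {μ : Fin n → EuclideanSpace ℝ (Fin q)}
    (h : NullHypothesis μ V c) :
    (WithLp.toLp 2 μ : DataSpace n q) ∈ (columnSpace q (contrastSpace V c))ᗮ := by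
  refine mem_columnSpace_orthogonal fun j => ?_
  rw [contrastSpace, Submodule.mem_orthogonal]
  intro u hu
  induction hu using Submodule.span_induction with
  | mem u hu =>
    obtain ⟨p, hp, rfl⟩ := hu
    have h2 := congrArg (fun v : EuclideanSpace ℝ (Fin q) => v j) (h p hp)
    rw [contrast, inner_sub_left, inner_normIndicator, inner_normIndicator, sub_eq_zero]
    simpa [average, column_apply] using h2
  | zero => simp
  | add u v _ _ hu hv => rw [inner_add_left, hu, hv, add_zero]
  | smul a u _ hu => rw [real_inner_smul_left, hu, mul_zero]

/-- Distinct clusters are disjoint, so a contrast cannot vanish at a member of its first cluster.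
This keeps the `χ` law free of atoms. -/
theorem finrank_contrastSpace_pos (hV : V.Nonempty) (hVall : ∀ p ∈ V, p.1 < p.2)
    (hc : TestedNonempty V c) : 0 < Module.finrank ℝ (contrastSpace V c) := by
  obtain ⟨p, hp⟩ := hV
  obtain ⟨i, hi⟩ := (hc p hp).1
  have hi1 : c (Fin.last J) i = p.1 := by simpa [cluster, members] using hi
  have hi2 : i ∉ cluster c p.2 := by simp [cluster, members, hi1, (hVall p hp).ne]
  rw [Module.finrank_pos_iff, Submodule.nontrivial_iff_ne_bot]
  intro hbot
  have h : contrast c p.1 p.2 = 0 := by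
    rw [← Submodule.mem_bot ℝ, ← hbot]
    exact Submodule.subset_span ⟨p, hp, rfl⟩
  have h2 := congrArg (fun v : EuclideanSpace ℝ (Fin n) => v i) h
  simp [contrast, normIndicator, hi, hi2] at h2
  simp [h2] at hi

end Columns

/-! ### Measurability of the algorithm, and reconstruction of the data. -/

section Measurability

theorem measurable_matrix {α : Type*} [MeasurableSpace α] {n q : ℕ}
    {f : α → Matrix (Fin n) (Fin q) ℝ} (h : ∀ i j, Measurable fun a => f a i j) : Measurable f :=
  measurable_pi_lambda _ fun i => measurable_pi_lambda _ fun j => h i j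

theorem measurable_matrix_entry {n q : ℕ} (i : Fin n) (j : Fin q) :
    Measurable fun A : Matrix (Fin n) (Fin q) ℝ => A i j :=
  (measurable_pi_apply j).comp (measurable_pi_apply (X := fun _ : Fin n => Fin q → ℝ) i)

theorem measurable_toMatrix {n q : ℕ} :
    Measurable (toMatrix : DataSpace n q → Matrix (Fin n) (Fin q) ℝ) :=
  measurable_matrix fun i j => by
    simp only [toMatrix_apply]
    fun_prop

theorem measurable_mul_matrix {n q : ℕ} (B : Matrix (Fin n) (Fin n) ℝ) :
    Measurable fun A : Matrix (Fin n) (Fin q) ℝ => B * A :=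
  measurable_matrix fun i j => by
    simp only [Matrix.mul_apply]
    exact Finset.measurable_sum _ fun k _ => (measurable_matrix_entry k j).const_mul _

theorem measurable_frob {n q : ℕ} :
    Measurable (frob : Matrix (Fin n) (Fin q) ℝ → ℝ) :=
  (Finset.measurable_sum _ fun i _ => Finset.measurable_sum _ fun j _ =>
    (measurable_matrix_entry i j).pow_const 2).sqrt

theorem measurable_row {n q : ℕ} (i : Fin n) :
    Measurable fun A : Matrix (Fin n) (Fin q) ℝ => row A i :=
  (WithLp.measurable_toLp 2 _).comp
    (measurable_pi_lambda _ fun j => measurable_matrix_entry i j)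

section

variable {n K q J : ℕ} (V : Finset (Fin K × Fin K)) (c : Outcome n K J)

theorem measurable_testStat (σ : ℝ) :
    Measurable (testStat σ V c : Matrix (Fin n) (Fin q) ℝ → ℝ) :=
  (measurable_frob.comp (measurable_mul_matrix _)).div_const _

theorem measurable_nuisance :
    Measurable (nuisance V c : Matrix (Fin n) (Fin q) ℝ → _) := by
  refine Measurable.prodMk (measurable_matrix fun i j => ?_) (measurable_mul_matrix _)
  exact (measurable_frob.comp (measurable_mul_matrix _)).inv.mul
    ((measurable_matrix_entry i j).comp (measurable_mul_matrix _))

end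

variable {n K q : ℕ} [NeZero K]

theorem nearest_eq_iff (m : Fin K → EuclideanSpace ℝ (Fin q)) (x : EuclideanSpace ℝ (Fin q))
    (k : Fin K) :
    nearest m x = k ↔ k ∈ closest m x ∧ ∀ l ∈ closest m x, k ≤ l := by
  constructor
  · rintro rfl
    exact ⟨Finset.min'_mem _ _, fun l hl => Finset.min'_le _ _ hl⟩
  · rintro ⟨h1, h2⟩
    exact le_antisymm (Finset.min'_le _ _ h1) (h2 _ (Finset.min'_mem _ _))

theorem measurable_nearest {α : Type*} [MeasurableSpace α]
    {m : α → Fin K → EuclideanSpace ℝ (Fin q)} {x : α → EuclideanSpace ℝ (Fin q)}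
    (hm : Measurable m) (hx : Measurable x) : Measurable fun a => nearest (m a) (x a) := by
  have hcl : ∀ k, MeasurableSet {a | k ∈ closest (m a) (x a)} := by
    intro k
    have h : {a | k ∈ closest (m a) (x a)} = ⋂ l, {a | ‖x a - m a k‖ ≤ ‖x a - m a l‖} := by
      ext a; simp [closest]
    rw [h]
    exact MeasurableSet.iInter fun l => measurableSet_le
      (hx.sub ((measurable_pi_apply k).comp hm)).norm (hx.sub ((measurable_pi_apply l).comp hm)).norm
  refine measurable_to_countable' fun k => ?_
  have h : (fun a => nearest (m a) (x a)) ⁻¹' {k} =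
      {a | k ∈ closest (m a) (x a)} ∩ ⋂ l, ({a | l ∈ closest (m a) (x a)}ᶜ ∪ {_a | k ≤ l}) := by
    ext a
    simp only [Set.mem_preimage, Set.mem_singleton_iff, nearest_eq_iff]
    simp [imp_iff_not_or]
  rw [h]
  exact (hcl k).inter (MeasurableSet.iInter fun l => (hcl l).compl.union (MeasurableSet.const _))

variable {m₀ : Matrix (Fin n) (Fin q) ℝ → Fin K → EuclideanSpace ℝ (Fin q)}

theorem measurable_centers (hm₀ : Measurable m₀) (j : ℕ) :
    Measurable fun A => centers m₀ A j := by
  induction j with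
  | zero => exact hm₀
  | succ j ih =>
    refine measurable_pi_lambda _ fun l => ?_
    have ha : Measurable fun A : Matrix (Fin n) (Fin q) ℝ =>
        fun i => nearest (centers m₀ A j) (row A i) :=
      measurable_pi_lambda _ fun i => measurable_nearest ih (measurable_row i)
    have hcard : Measurable fun A : Matrix (Fin n) (Fin q) ℝ =>
        (members (fun i => nearest (centers m₀ A j) (row A i)) l).card :=
      (measurable_of_countable fun a : Fin n → Fin K => (members a l).card).comp ha
    simp only [centers]
    refine Measurable.ite (hcard (measurableSet_singleton 0)) ((measurable_pi_apply l).comp ih) ?_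
    -- The summation set depends on `A`; as a sum over all rows of terms cut off by membership, it
    -- has a fixed index set.
    simp only [average, members, Finset.sum_filter]
    refine Measurable.smul ((measurable_of_countable fun k : ℕ => (k : ℝ)).comp hcard).inv
      (Finset.measurable_sum _ fun i _ => ?_)
    exact Measurable.ite (((measurable_pi_apply i).comp ha) (measurableSet_singleton l))
      (measurable_row i) measurable_const

theorem measurable_kmeans (hm₀ : Measurable m₀) (J : ℕ) : Measurable (kmeans J m₀) :=
  measurable_pi_lambda _ fun j => measurable_pi_lambda _ fun i =>
    measurable_nearest (measurable_centers hm₀ j) (measurable_row i)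

/-- The pairs `(z, ψ)` of a value of the nuisance statistic and a value of the test statistic for
which the data reconstructed from them have the outcome `c`. -/
def selectionSet {J : ℕ} (m₀ : Matrix (Fin n) (Fin q) ℝ → Fin K → EuclideanSpace ℝ (Fin q))
    (σ : ℝ) (c : Outcome n K J) :
    Set ((Matrix (Fin n) (Fin q) ℝ × Matrix (Fin n) (Fin q) ℝ) × ℝ) :=
  {p | 0 ≤ p.2 ∧ kmeans J m₀ (p.2 • (σ • p.1.1) + p.1.2) = c}

theorem measurableSet_selectionSet {J : ℕ} (hm₀ : Measurable m₀) (σ : ℝ) (c : Outcome n K J) :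
    MeasurableSet (selectionSet m₀ σ c) := by
  refine (measurableSet_le measurable_const measurable_snd).inter ?_
  refine ((measurable_kmeans hm₀ J).comp (measurable_matrix fun i j => ?_))
    (measurableSet_singleton c)
  exact (measurable_snd.mul (((measurable_matrix_entry i j).comp measurable_fst.fst).const_mul σ)).add
    ((measurable_matrix_entry i j).comp measurable_fst.snd)

variable {σ : ℝ} {V : Finset (Fin K × Fin K)}

theorem kmeans_eq_iff_mem_selectionSet {J : ℕ} (hσ : 0 < σ) (c : Outcome n K J)
    (A : Matrix (Fin n) (Fin q) ℝ) :
    kmeans J m₀ A = c ↔ (nuisance V c A, testStat σ V c A) ∈ selectionSet m₀ σ c := by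
  have h0 : 0 ≤ testStat σ V c A := div_nonneg (Real.sqrt_nonneg _) hσ.le
  have hA : testStat σ V c A • (σ • (nuisance V c A).1) + (nuisance V c A).2 = A := by
    have h : testStat σ V c A • (σ • (nuisance V c A).1) = projMatrix V c * A := by
      simp only [testStat, nuisance, smul_smul]
      -- If the projection vanishes, its normalised direction is `0` by the convention `0⁻¹ = 0`,
      -- and the reconstruction remains correct.
      by_cases hf : frob (projMatrix V c * A) = 0
      · rw [frob_eq_zero hf, smul_zero]
      · rw [← mul_assoc, div_mul_cancel₀ _ hσ.ne', mul_inv_cancel₀ hf, one_smul]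
    rw [h, nuisance, Matrix.sub_mul, Matrix.one_mul]
    exact add_sub_cancel _ _
  simp only [selectionSet, Set.mem_ofPred_eq, hA, h0, true_and]

theorem truncSet_eq_preimage_selectionSet {J : ℕ} {c : Outcome n K J}
    {A : Matrix (Fin n) (Fin q) ℝ} (h : kmeans J m₀ A = c) :
    truncSet J m₀ σ V A = Prod.mk (nuisance V c A) ⁻¹' selectionSet m₀ σ c := by
  ext ψ
  simp only [truncSet, selectionSet, perturb, nuisance, h, Set.mem_ofPred_eq, Set.mem_preimage,
    smul_smul, div_eq_mul_inv, mul_assoc, eq_comm (a := c)]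

end Measurability

/-- Handles statistics whose defining space is itself chosen by the random outcome. -/
theorem measurable_of_countable_index {Ω ι α γ : Type*} [MeasurableSpace Ω] [MeasurableSpace ι]
    [MeasurableSpace α] [MeasurableSpace γ] [Countable ι] [MeasurableSingletonClass ι]
    {F : ι → α → γ} (hF : ∀ c, Measurable (F c)) {f : Ω → ι} {g : Ω → α} (hf : Measurable f)
    (hg : Measurable g) : Measurable fun ω => F (f ω) (g ω) :=
  (measurable_from_prod_countable_right (f := fun p : ι × α => F p.1 p.2) hF).comp (hf.prodMk hg)

/-! ### The statistics of the random data matrix. -/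

section Data

variable {Ω : Type*} [MeasurableSpace Ω] {n q K J : ℕ}
  {X : Fin n → Ω → EuclideanSpace ℝ (Fin q)}

theorem measurable_dataMatrix (hX : ∀ i, Measurable (X i)) : Measurable (dataMatrix X) :=
  measurable_matrix fun i j => by
    simp only [dataMatrix, Matrix.of_apply]
    fun_prop

/-- Under the null hypothesis for a fixed outcome `c`, the test statistic has the `χ_d` distribution
and is independent of the nuisance statistic. -/
theorem exists_map_nuisance_testStat {P : Measure Ω} [IsProbabilityMeasure P] (hq : 0 < q)
    {σ : ℝ} (hσ : 0 < σ) {μ : Fin n → EuclideanSpace ℝ (Fin q)} (hX : ∀ i, Measurable (X i))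
    (hindep : iIndepFun X P)
    (hlaw : ∀ i, P.map (X i) =
      multivariateGaussian (μ i) (σ ^ 2 • (1 : Matrix (Fin q) (Fin q) ℝ)))
    {V : Finset (Fin K × Fin K)} (hV : V.Nonempty) (hVall : ∀ p ∈ V, p.1 < p.2)
    {c : Outcome n K J} (hc : TestedNonempty V c) (hnull : NullHypothesis μ V c) :
    ∃ ν : Measure (Matrix (Fin n) (Fin q) ℝ × Matrix (Fin n) (Fin q) ℝ),
      P.map (fun ω => (nuisance V c (dataMatrix X ω), testStat σ V c (dataMatrix X ω))) =
        ν.prod (chiMeasure (q * Module.finrank ℝ (contrastSpace V c))) := by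
  set F : Submodule ℝ (DataSpace n q) := columnSpace q (contrastSpace V c) with hF
  have : Nontrivial F := by
    refine Module.finrank_pos_iff (R := ℝ).1 ?_
    rw [finrank_columnSpace]
    exact Nat.mul_pos hq (finrank_contrastSpace_pos hV hVall hc)
  obtain ⟨ν, _, hν⟩ := exists_map_polar_starProjection F hσ (toLp_mem_columnSpace_orthogonal hnull)
  refine ⟨ν.map (Prod.map toMatrix toMatrix), ?_⟩
  have hfun : (fun ω => (nuisance V c (dataMatrix X ω), testStat σ V c (dataMatrix X ω))) =
      Prod.map (Prod.map toMatrix toMatrix) id ∘ (fun x : DataSpace n q =>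
        ((‖F.starProjection x‖⁻¹ • F.starProjection x, x - F.starProjection x),
          ‖F.starProjection x‖ / σ)) ∘
        (fun ω => (WithLp.toLp 2 fun i => X i ω : DataSpace n q)) := by
    funext ω
    have h : dataMatrix X ω = toMatrix (WithLp.toLp 2 fun i => X i ω) := rfl
    rw [h, nuisance_toMatrix, testStat_toMatrix]
    rfl
  have hm : Measurable (Prod.map (toMatrix (n := n) (q := q)) (toMatrix (n := n) (q := q))) :=
    measurable_toMatrix.prodMap measurable_toMatrix
  rw [hfun, ← Measure.map_map (hm.prodMap measurable_id) (by fun_prop),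
    ← Measure.map_map (by fun_prop) (by fun_prop), map_data_eq_map_stdGaussian hX hindep hlaw, hν,
    ← Measure.map_prod_map _ _ hm measurable_id, Measure.map_id, hF, finrank_columnSpace]

variable [NeZero K] {m₀ : Matrix (Fin n) (Fin q) ℝ → Fin K → EuclideanSpace ℝ (Fin q)}

theorem measurable_outcome (hm₀ : Measurable m₀) (hX : ∀ i, Measurable (X i)) :
    Measurable (outcome J m₀ X) :=
  (measurable_kmeans hm₀ J).comp (measurable_dataMatrix hX)

theorem measurable_Tσ (hm₀ : Measurable m₀) (hX : ∀ i, Measurable (X i)) (σ : ℝ)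
    (V : Finset (Fin K × Fin K)) : Measurable (Tσ J m₀ σ V X) :=
  measurable_of_countable_index (fun c => measurable_testStat V c σ) (measurable_outcome hm₀ hX)
    (measurable_dataMatrix hX)

theorem measurable_nuisance_outcome (hm₀ : Measurable m₀) (hX : ∀ i, Measurable (X i))
    (V : Finset (Fin K × Fin K)) :
    Measurable fun ω => nuisance V (outcome J m₀ X ω) (dataMatrix X ω) :=
  measurable_of_countable_index (fun c => measurable_nuisance V c) (measurable_outcome hm₀ hX)
    (measurable_dataMatrix hX)

end Data

end ClusterInference

/-! ### The truncated `χ` law and the uniform p-value. -/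

open ClusterInference in
theorem mainTheorem2
    {Ω : Type*} [MeasurableSpace Ω] (P : Measure Ω) [IsProbabilityMeasure P]
    {n q K : ℕ} [NeZero K] (hq : 0 < q) (J : ℕ)
    (m₀ : Matrix (Fin n) (Fin q) ℝ → Fin K → EuclideanSpace ℝ (Fin q)) (hm₀ : Measurable m₀)
    (σ : ℝ) (hσ : 0 < σ) (μ : Fin n → EuclideanSpace ℝ (Fin q))
    (X : Fin n → Ω → EuclideanSpace ℝ (Fin q)) (hX : ∀ i, Measurable (X i))
    (hindep : iIndepFun X P)
    (hlaw : ∀ i, P.map (X i) = multivariateGaussian (μ i) (σ ^ 2 • (1 : Matrix (Fin q) (Fin q) ℝ)))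
    (V : Finset (Fin K × Fin K)) (hV : V.Nonempty) (hVall : ∀ p ∈ V, p.1 < p.2) :
    (∀ᵐ ω ∂P,
      ClusterInference.TestedNonempty V (ClusterInference.outcome J m₀ X ω) →
      ClusterInference.NullHypothesis μ V (ClusterInference.outcome J m₀ X ω) →
      ∀ t : ℝ, ClusterInference.Qσ P J m₀ σ V X ω t =
        ClusterInference.truncCDF
          (ClusterInference.chiMeasure (q * Module.finrank ℝ
            (ClusterInference.contrastSpace V (ClusterInference.outcome J m₀ X ω))))
          (ClusterInference.truncSet J m₀ σ V (ClusterInference.dataMatrix X ω)) t) ∧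
    (∀ c : ClusterInference.Outcome n K J,
      P {ω | ClusterInference.outcome J m₀ X ω = c} ≠ 0 →
      ClusterInference.TestedNonempty V c →
      ClusterInference.NullHypothesis μ V c →
      ∀ α : ℝ, 0 ≤ α → α ≤ 1 →
        P[{ω | ClusterInference.pσ P J m₀ σ V X ω ≤ α} |
          {ω | ClusterInference.outcome J m₀ X ω = c}] = ENNReal.ofReal α) := by
  have hC := measurable_outcome (J := J) hm₀ hX
  have hZ := measurable_nuisance_outcome (J := J) hm₀ hX V
  have hT := measurable_Tσ (J := J) hm₀ hX σ V
  have hZc := fun c : Outcome n K J =>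
    (measurable_nuisance (q := q) V c).comp (measurable_dataMatrix hX)
  have hTc := fun c : Outcome n K J =>
    (measurable_testStat (q := q) V c σ).comp (measurable_dataMatrix hX)
  have hZeq : ∀ c ω, outcome J m₀ X ω = c →
      nuisance V (outcome J m₀ X ω) (dataMatrix X ω) = nuisance V c (dataMatrix X ω) := by
    rintro c ω rfl
    rfl
  have hTeq : ∀ c ω, outcome J m₀ X ω = c →
      Tσ J m₀ σ V X ω = testStat σ V c (dataMatrix X ω) := by
    rintro c ω rfl
    rfl
  constructor
  -- The almost sure statement is proved for each fixed outcome, where the hypotheses on `c` are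
  -- deterministic, and then united over the finitely many outcomes.
  · have h : ∀ c : Outcome n K J, ∀ᵐ ω ∂P, TestedNonempty V c → NullHypothesis μ V c →
        outcome J m₀ X ω = c → ∀ t, Qσ P J m₀ σ V X ω t =
          truncCDF (chiMeasure (q * Module.finrank ℝ (contrastSpace V c)))
            (truncSet J m₀ σ V (dataMatrix X ω)) t := by
      intro c
      by_cases hc : TestedNonempty V c ∧ NullHypothesis μ V c
      · obtain ⟨ν, hν⟩ :=
          exists_map_nuisance_testStat hq hσ hX hindep hlaw hV hVall hc.1 hc.2
        filter_upwards [cdf_condDistrib_eq_truncCDF hC hZ hT (hZc c) (hTc c)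
          (measurableSet_selectionSet hm₀ σ c) (hZeq c) (hTeq c) hν
          fun ω => kmeans_eq_iff_mem_selectionSet hσ c (dataMatrix X ω)] with ω hω _ _ hωc t
        rw [truncSet_eq_preimage_selectionSet hωc]
        rw [hZeq c ω hωc] at hω
        rw [← hω hωc t, ← hZeq c ω hωc]
        rfl
      · exact Filter.Eventually.of_forall fun ω h1 h2 => absurd ⟨h1, h2⟩ hc
    filter_upwards [ae_all_iff.2 h] with ω hω h1 h2
    exact hω _ h1 h2 rfl
  · intro c hPc hc hnull α h0 h1
    obtain ⟨ν, hν⟩ := exists_map_nuisance_testStat hq hσ hX hindep hlaw hV hVall hc hnull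
    have := nullSingletonClass_chiMeasure
      (Nat.mul_pos hq (finrank_contrastSpace_pos hV hVall hc))
    exact cond_one_sub_cdf_condDistrib_le hC hZ hT (hZc c) (hTc c)
      (measurableSet_selectionSet hm₀ σ c) (hZeq c) (hTeq c) hν
      (fun ω => kmeans_eq_iff_mem_selectionSet hσ c (dataMatrix X ω)) hPc h0 h1
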